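/- Let $1\le p<\infty$, let $\ell_p(\mathbb Z)$ be the Banach space of complex sequences $x=(x_n)_{n\in\mathbb Z}$ with $\sum_{n\in\mathbb Z}|x_n|^p<\infty$, and let $B$ be the unweighted bilateral shift on $\ell_p(\mathbb Z)$, i.e. the bounded linear operator with $Be_n=e_{n-1}$ for all $n\in\mathbb Z$, where $(e_n)_{n\in\mathbb Z}$ is the canonical basis. A bounded linear operator $T$ on a complex Banach space $X$ is called weakly supercyclic if there is $x\in X$ whose projective orbit $\{\lambda T^n x : n=0,1,2,\dots,\ \lambda\in\mathbb C\}$ is dense in $X$ with respect to the weak topology. Then $B$ is weakly supercyclic if and only if $p>2$. -/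

import Mathlib

open scoped ENNReal

/-- The projective orbit `{c • Tⁿ x : n = 0, 1, 2, …, c ∈ ℂ}` of `x` under `T`. -/
def projectiveOrbit {E : Type*} [NormedAddCommGroup E] [NormedSpace ℂ E]
    (T : E →L[ℂ] E) (x : E) : Set E :=
  {y | ∃ (c : ℂ) (n : ℕ), y = c • (T ^ n) x}

/-- `x` is a weakly supercyclic vector for `T` if its projective orbit is dense in the
weak topology of `E`. -/
def IsWeaklySupercyclicVector {E : Type*} [NormedAddCommGroup E] [NormedSpace ℂ E]
    (T : E →L[ℂ] E) (x : E) : Prop :=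
  Dense (toWeakSpace ℂ E '' projectiveOrbit T x)

/-- `T` is weakly supercyclic if it has a weakly supercyclic vector. -/
def IsWeaklySupercyclic {E : Type*} [NormedAddCommGroup E] [NormedSpace ℂ E]
    (T : E →L[ℂ] E) : Prop :=
  ∃ x : E, IsWeaklySupercyclicVector T x

theorem memℓp_shift {p : ℝ≥0∞} {x : ℤ → ℂ} (hx : Memℓp x p) :
    Memℓp (fun n => x (n + 1)) p := by
  rcases p.trichotomy with rfl | rfl | hp
  · rw [memℓp_zero_iff] at hx ⊢
    exact hx.preimage (add_left_injective (1 : ℤ)).injOn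
  · rw [memℓp_infty_iff] at hx ⊢
    refine hx.mono ?_
    rintro _ ⟨n, rfl⟩
    exact ⟨n + 1, rfl⟩
  · rw [memℓp_gen_iff hp] at hx ⊢
    exact hx.comp_injective (add_left_injective (1 : ℤ))

/-- The unweighted bilateral shift `B` on the complex space `ℓ_p(ℤ)`: `(B x)(n) = x(n + 1)`. -/
noncomputable def bilateralShift (p : ℝ≥0∞) [Fact (1 ≤ p)] :
    lp (fun _ : ℤ => ℂ) p →L[ℂ] lp (fun _ : ℤ => ℂ) p :=
  LinearMap.mkContinuous
    { toFun := fun x => ⟨fun n => x (n + 1), memℓp_shift (lp.memℓp x)⟩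
      map_add' := fun _ _ => rfl
      map_smul' := fun _ _ => rfl }
    1 (by
      intro x
      have hp1 : (1 : ℝ≥0∞) ≤ p := Fact.out
      have hp0 : p ≠ 0 := (zero_lt_one.trans_le hp1).ne'
      rw [one_mul]
      rcases eq_or_ne p ∞ with rfl | hp
      · exact lp.norm_le_of_forall_le (norm_nonneg x)
          fun n => lp.norm_apply_le_norm hp0 x (n + 1)
      · have hpos : 0 < p.toReal := ENNReal.toReal_pos hp0 hp
        rw [lp.norm_eq_tsum_rpow hpos, lp.norm_eq_tsum_rpow hpos]
        exact le_of_eq (congrArg (fun t : ℝ => t ^ (1 / p.toReal))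
          ((Equiv.addRight (1 : ℤ)).tsum_eq fun n => ‖x n‖ ^ p.toReal)))

theorem bilateralShift_apply (p : ℝ≥0∞) [Fact (1 ≤ p)] (x : lp (fun _ : ℤ => ℂ) p) (n : ℤ) :
    bilateralShift p x n = x (n + 1) :=
  rfl

/-- `B eₙ = eₙ₋₁` on the canonical basis. -/
theorem bilateralShift_single (p : ℝ≥0∞) [Fact (1 ≤ p)] (n : ℤ) :
    bilateralShift p (lp.single p n 1) = lp.single p (n - 1) 1 := by
  ext m
  rw [bilateralShift_apply, lp.single_apply, lp.single_apply, Pi.single_apply, Pi.single_apply]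
  simp only [eq_sub_iff_add_eq]

/-! For `p > 2`, take a norm-dense sequence of finitely supported `u_k` and let `x` be a sum of far
translates of small multiples of them, infinitely many for each `k`, with weights `s (k, l)` that
lie in `ℓ_p` but, for fixed `k`, not in `ℓ_2`. Shifting one translate back to the origin leaves an
error `R l`. If the differences of positions are distinct, the errors have an upper `ℓ_p`-estimate,
so `∑ s_l |w (R l)| < ∞` for every functional `w`. As `∑ s_l ^ 2 = ∞`, finitely many functionals
cannot keep every `R l / s_l` away from `0`, and `u_k` lies in the weak closure of the projective
orbit.

For `p ≤ 2`, pass to `ℓ_2`, where `B` becomes multiplication by a character of the circle. A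
multiplier turns the orbit of `x ≠ 0` into a Bessel sequence of constant nonzero norm. Bang's lemma
and weak-* compactness then give `ψ` with `|ψ y| ≥ δ (|y 0| + |y 1|)` on the projective orbit, hence
on its weak closure. This fails somewhere, because `ker ψ` has codimension at most one. -/

theorem mem_closure_toWeakSpace_image {E : Type*} [NormedAddCommGroup E] [NormedSpace ℂ E]
    {S : Set E} {z : E}
    (h : ∀ (W : Finset (E →L[ℂ] ℂ)) (ε : ℝ), 0 < ε → ∃ y ∈ S, ∀ w ∈ W, ‖w (y - z)‖ < ε) :
    toWeakSpace ℂ E z ∈ closure (toWeakSpace ℂ E '' S) := by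
  have hs := LinearMap.weakBilin_withSeminorms (topDualPairing ℂ E).flip
  rw [mem_closure_iff_nhds]
  intro U hU
  obtain ⟨W, r, hr, hW⟩ := (hs.mem_nhds_iff (toWeakSpace ℂ E z) U).1 hU
  obtain ⟨y, hyS, hy⟩ := h W r hr
  refine ⟨toWeakSpace ℂ E y, hW ?_, y, hyS, rfl⟩
  exact Seminorm.mem_ball _ |>.2 (Seminorm.finset_sup_apply_lt hr hy)

/-- If `R` has an upper `ℓ_r`-estimate and `s ∈ ℓ_r ∖ ℓ_2`, then `0` is in the weak closure of
the vectors `R j / s j`. -/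
theorem exists_forall_norm_lt_of_upper_estimate {E ι : Type*} [NormedAddCommGroup E]
    [NormedSpace ℂ E] {R : ι → E} {s : ι → ℝ} {r C : ℝ} (hs : ∀ j, 0 < s j) (hr : 0 < r)
    (hC : 0 ≤ C)
    (hR : ∀ (F : Finset ι) (c : ι → ℂ), ‖∑ j ∈ F, c j • R j‖ ≤ C * (∑ j ∈ F, ‖c j‖ ^ r) ^ (1 / r))
    (hsr : Summable fun j => s j ^ r) (hs2 : ¬ Summable fun j => s j ^ 2)
    (W : Finset (E →L[ℂ] ℂ)) {δ : ℝ} (hδ : 0 < δ) : ∃ j, ∀ w ∈ W, ‖w (R j)‖ < δ * s j := by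
  by_contra! hcon
  set T : ℝ := (∑' j, s j ^ r) ^ (1 / r) with hT
  -- Test `w` on `∑ s j • c j • R j`, with unimodular `c j` that align the phases.
  have key : ∀ (F : Finset ι) (w : E →L[ℂ] ℂ), ∑ j ∈ F, s j * ‖w (R j)‖ ≤ ‖w‖ * (C * T) := by
    intro F w
    choose c hc1 hc2 using fun j => RCLike.exists_norm_eq_mul_self (w (R j))
    have hnorm : ∀ j, ‖(s j : ℂ) * c j‖ = s j := fun j => by
      rw [norm_mul, hc1, mul_one, Complex.norm_real, Real.norm_of_nonneg (hs j).le]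
    have h1 : w (∑ j ∈ F, ((s j : ℂ) * c j) • R j) = ((∑ j ∈ F, s j * ‖w (R j)‖ : ℝ) : ℂ) := by
      rw [map_sum]
      push_cast
      refine Finset.sum_congr rfl fun j _ => ?_
      rw [map_smul, smul_eq_mul, mul_assoc, ← hc2]
      rfl
    have h0 : 0 ≤ ∑ j ∈ F, s j * ‖w (R j)‖ :=
      Finset.sum_nonneg fun j _ => mul_nonneg (hs j).le (norm_nonneg _)
    calc ∑ j ∈ F, s j * ‖w (R j)‖ = ‖w (∑ j ∈ F, ((s j : ℂ) * c j) • R j)‖ := by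
          rw [h1, Complex.norm_real, Real.norm_of_nonneg h0]
      _ ≤ ‖w‖ * ‖∑ j ∈ F, ((s j : ℂ) * c j) • R j‖ := w.le_opNorm _
      _ ≤ ‖w‖ * (C * (∑ j ∈ F, s j ^ r) ^ (1 / r)) := by
          gcongr
          simpa only [hnorm] using hR F fun j => (s j : ℂ) * c j
      _ ≤ ‖w‖ * (C * T) := by
          have : ∑ j ∈ F, s j ^ r ≤ ∑' j, s j ^ r :=
            hsr.sum_le_tsum F fun j _ => Real.rpow_nonneg (hs j).le r
          have h2 : 0 ≤ ∑ j ∈ F, s j ^ r :=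
            Finset.sum_nonneg fun j _ => Real.rpow_nonneg (hs j).le r
          rw [hT]
          gcongr
  refine hs2 ?_
  -- By `hcon` each `j` is bad for some `w ∈ W`; summing over the finite `W` absorbs the dependence
  -- on `j`.
  have : Summable fun j => δ * s j ^ 2 := by
    refine summable_of_sum_le (c := ∑ w ∈ W, ‖w‖ * (C * T)) (fun j => by positivity) fun F => ?_
    calc ∑ j ∈ F, δ * s j ^ 2 ≤ ∑ j ∈ F, ∑ w ∈ W, s j * ‖w (R j)‖ := by
          refine Finset.sum_le_sum fun j _ => ?_
          obtain ⟨w, hw, hle⟩ := hcon j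
          calc δ * s j ^ 2 = s j * (δ * s j) := by ring
            _ ≤ s j * ‖w (R j)‖ := mul_le_mul_of_nonneg_left hle (hs j).le
            _ ≤ _ := Finset.single_le_sum (f := fun w : E →L[ℂ] ℂ => s j * ‖w (R j)‖)
                (fun w _ => mul_nonneg (hs j).le (norm_nonneg _)) hw
      _ = ∑ w ∈ W, ∑ j ∈ F, s j * ‖w (R j)‖ := Finset.sum_comm
      _ ≤ _ := Finset.sum_le_sum fun w _ => key F w
  exact (summable_mul_left_iff hδ.ne').1 this

/-! ### Translated blocks in `ℓ_p(ℤ)` -/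

section Block

variable (p : ℝ≥0∞)

/-- The finitely supported sequence `y`, translated by `t`, as a vector of `ℓ_p(ℤ)`. -/
noncomputable def translatedBlock (t : ℤ) (y : ℤ →₀ ℂ) : lp (fun _ : ℤ => ℂ) p :=
  y.sum fun m c => lp.single p (t + m) c

theorem lp_norm_sum_single_of_injOn {ι : Type*} {p : ℝ≥0∞} [Fact (1 ≤ p)] (hp : 0 < p.toReal) {F : Finset ι}
    {σ : ι → ℤ} (hσ : Set.InjOn σ F) (b : ι → ℂ) :
    ‖∑ i ∈ F, (lp.single p (σ i) (b i) : lp (fun _ : ℤ => ℂ) p)‖ =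
      (∑ i ∈ F, ‖b i‖ ^ p.toReal) ^ (1 / p.toReal) := by
  classical
  rcases F.eq_empty_or_nonempty with rfl | ⟨i₀, -⟩
  · simp [Real.zero_rpow (inv_ne_zero hp.ne')]
  have : Nonempty ι := ⟨i₀⟩
  have hinv : ∀ i ∈ F, Function.invFunOn σ F (σ i) = i := fun i hi =>
    hσ.leftInvOn_invFunOn hi
  have h := lp.norm_sum_single (E := fun _ : ℤ => ℂ) hp
    (fun n => b (Function.invFunOn σ F n)) (F.image σ)
  rw [Finset.sum_image hσ, Finset.sum_image hσ] at h
  have hb : ∀ i ∈ F, b (Function.invFunOn σ F (σ i)) = b i := fun i hi => by rw [hinv i hi]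
  rw [Finset.sum_congr rfl fun i hi => congrArg (lp.single p (σ i)) (hb i hi),
    Finset.sum_congr rfl fun i hi => congrArg (fun z : ℂ => ‖z‖ ^ p.toReal) (hb i hi)] at h
  rw [← h, ← Real.rpow_mul (norm_nonneg _), mul_one_div_cancel hp.ne', Real.rpow_one]

theorem translatedBlock_smul (t : ℤ) (c : ℂ) (y : ℤ →₀ ℂ) :
    translatedBlock p t (c • y) = c • translatedBlock p t y := by
  rw [translatedBlock, translatedBlock, Finsupp.sum_smul_index fun _ => lp.single_zero _ _,
    Finsupp.smul_sum]
  exact Finset.sum_congr rfl fun m _ => lp.single_smul (E := fun _ : ℤ => ℂ) p (t + m) c (y m)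

variable [Fact (1 ≤ p)]

/-- The blocks may overlap. For a fixed offset `m` the positions `τ i + m` are still distinct, so
that layer has an exact `ℓ_p`-norm; the triangle inequality over `m` costs only `∑ g m`. -/
theorem norm_sum_smul_translatedBlock_le {ι : Type*} (hp : 0 < p.toReal) {F : Finset ι}
    (a : ι → ℂ) {τ : ι → ℤ} (hτ : Set.InjOn τ F) {y : ι → ℤ →₀ ℂ} {g : ℤ → ℝ} (hg : Summable g)
    (hy : ∀ i m, ‖y i m‖ ≤ g m) :
    ‖∑ i ∈ F, a i • translatedBlock p (τ i) (y i)‖ ≤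
      (∑' m, g m) * (∑ i ∈ F, ‖a i‖ ^ p.toReal) ^ (1 / p.toReal) := by
  classical
  rcases F.eq_empty_or_nonempty with rfl | ⟨i₀, -⟩
  · simp [Real.zero_rpow (inv_ne_zero hp.ne')]
  have hg0 : ∀ m, 0 ≤ g m := fun m => (norm_nonneg _).trans (hy i₀ m)
  set M : Finset ℤ := F.biUnion fun i => (y i).support
  have hblock : ∀ i ∈ F, a i • translatedBlock p (τ i) (y i) =
      ∑ m ∈ M, (lp.single p (τ i + m) (a i * y i m) : lp (fun _ : ℤ => ℂ) p) := by
    intro i hi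
    have hsub : (y i).support ⊆ M := Finset.subset_biUnion_of_mem (fun i => (y i).support) hi
    rw [translatedBlock, Finsupp.sum_of_support_subset _ hsub _ fun m _ => lp.single_zero _ _,
      Finset.smul_sum]
    exact Finset.sum_congr rfl fun m _ => (lp.single_smul p _ _ _).symm
  rw [Finset.sum_congr rfl hblock, Finset.sum_comm]
  set A : ℝ := (∑ i ∈ F, ‖a i‖ ^ p.toReal) ^ (1 / p.toReal)
  have hA : 0 ≤ A := by positivity
  have hterm : ∀ m ∈ M,
      ‖∑ i ∈ F, (lp.single p (τ i + m) (a i * y i m) : lp (fun _ : ℤ => ℂ) p)‖ ≤ g m * A := by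
    intro m _
    rw [lp_norm_sum_single_of_injOn hp (fun i hi j hj h => hτ hi hj (add_right_cancel h))]
    have : g m * A = (∑ i ∈ F, (‖a i‖ * g m) ^ p.toReal) ^ (1 / p.toReal) := by
      simp_rw [Real.mul_rpow (norm_nonneg _) (hg0 m)]
      rw [← Finset.sum_mul, Real.mul_rpow (by positivity) (Real.rpow_nonneg (hg0 m) _),
        ← Real.rpow_mul (hg0 m), mul_one_div_cancel hp.ne', Real.rpow_one, mul_comm]
    rw [this]
    gcongr with i _
    rw [norm_mul]
    gcongr
    exact hy i m
  calc _ ≤ ∑ m ∈ M, g m * A := norm_sum_le_of_le _ hterm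
    _ = (∑ m ∈ M, g m) * A := (Finset.sum_mul _ _ _).symm
    _ ≤ _ := by
      gcongr
      exact hg.sum_le_tsum _ fun m _ => hg0 m

theorem bilateralShift_pow_apply (n : ℕ) (x : lp (fun _ : ℤ => ℂ) p) (m : ℤ) :
    (bilateralShift p ^ n) x m = x (m + n) := by
  induction n generalizing x m with
  | zero => simp
  | succ n ih =>
    rw [pow_succ, mul_apply_eq_comp, ih, bilateralShift_apply]
    push_cast
    ring_nf

theorem bilateralShift_pow_translatedBlock (n : ℕ) (t : ℤ) (y : ℤ →₀ ℂ) :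
    (bilateralShift p ^ n) (translatedBlock p t y) = translatedBlock p (t - n) y := by
  rw [translatedBlock, translatedBlock, Finsupp.sum, Finsupp.sum, map_sum]
  refine Finset.sum_congr rfl fun m _ => ?_
  ext k
  rw [bilateralShift_pow_apply, lp.single_apply, lp.single_apply, Pi.single_apply, Pi.single_apply]
  congr 1
  apply propext
  constructor <;> intro h <;> linarith

end Block

/-! ### The candidate vector and its errors -/

section Construction

variable {p : ℝ≥0∞} [Fact (1 ≤ p)] {ι : Type*} {s : ι → ℝ} {n : ι → ℕ} {y : ι → ℤ →₀ ℂ} {g : ℤ → ℝ}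

/-- The weights need not be summable, so the Cauchy criterion is checked through the `ℓ_p`-bound on
finite sums. -/
theorem summable_smul_translatedBlock (hp : 0 < p.toReal) (hs : ∀ i, 0 ≤ s i)
    (hsp : Summable fun i => s i ^ p.toReal) (hn : Function.Injective n) (hg : Summable g)
    (hy : ∀ i m, ‖y i m‖ ≤ g m) :
    Summable fun i => (s i : ℂ) • translatedBlock p (n i) (y i) := by
  set G := ∑' m, g m
  have hbound : ∀ F : Finset ι, ‖∑ i ∈ F, (s i : ℂ) • translatedBlock p (n i) (y i)‖ ≤
      G * (∑ i ∈ F, s i ^ p.toReal) ^ (1 / p.toReal) := by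
    intro F
    have h := norm_sum_smul_translatedBlock_le p hp (F := F) (fun i => (s i : ℂ))
      (τ := fun i => (n i : ℤ)) (fun i _ j _ h => hn (Nat.cast_injective h)) hg hy
    simpa only [Complex.norm_real, Real.norm_of_nonneg (hs _)] using h
  rw [summable_iff_vanishing_norm]
  intro ε hε
  have hcont : Filter.Tendsto (fun t : ℝ => G * t ^ (1 / p.toReal)) (nhds 0) (nhds 0) := by
    have : Continuous fun t : ℝ => G * t ^ (1 / p.toReal) :=
      continuous_const.mul (Real.continuous_rpow_const (by positivity))
    simpa [Real.zero_rpow (inv_ne_zero hp.ne')] using this.tendsto 0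
  obtain ⟨δ, hδ, hball⟩ := Metric.eventually_nhds_iff.1 (hcont.eventually (gt_mem_nhds hε))
  obtain ⟨S, hS⟩ := (summable_iff_vanishing_norm.1 hsp) δ hδ
  refine ⟨S, fun F hF => (hbound F).trans_lt (hball ?_)⟩
  rw [dist_zero_right]
  exact hS F hF

/-- The error of the rescaled approximation of `translatedBlock p 0 (y j)` by the `n j`-th shift of
a sum of widely spaced blocks satisfies an upper `ℓ_p`-estimate. -/
theorem norm_sum_smul_shift_sub_le (hp : 0 < p.toReal) (hs : ∀ i, 0 ≤ s i)
    (hsp : Summable fun i => s i ^ p.toReal) (hn : Function.Injective n)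
    (hsidon : ∀ i j i' j', i ≠ j → (n i : ℤ) - n j = n i' - n j' → i = i' ∧ j = j')
    (hg : Summable g) (hy : ∀ i m, ‖y i m‖ ≤ g m) (F : Finset ι) (c : ι → ℂ) :
    ‖∑ j ∈ F, c j • ((bilateralShift p ^ n j) (∑' i, (s i : ℂ) • translatedBlock p (n i) (y i)) -
        (s j : ℂ) • translatedBlock p 0 (y j))‖ ≤
      ((∑' m, g m) * (∑' i, s i ^ p.toReal) ^ (1 / p.toReal)) *
        (∑ j ∈ F, ‖c j‖ ^ p.toReal) ^ (1 / p.toReal) := by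
  classical
  rcases isEmpty_or_nonempty ι with hι | ⟨⟨i₀⟩⟩
  · simp [Finset.eq_empty_of_isEmpty F, Real.zero_rpow (inv_ne_zero hp.ne')]
  have hg0 : ∀ m, 0 ≤ g m := fun m => (norm_nonneg _).trans (hy i₀ m)
  have hG : 0 ≤ ∑' m, g m := tsum_nonneg hg0
  set x := ∑' i, (s i : ℂ) • translatedBlock p (n i) (y i)
  have hx : HasSum (fun i => (s i : ℂ) • translatedBlock p (n i) (y i)) x :=
    (summable_smul_translatedBlock hp hs hsp hn hg hy).hasSum
  set f : ι → ι → lp (fun _ : ℤ => ℂ) p := fun j i =>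
    if i = j then 0 else (s i : ℂ) • translatedBlock p (n i - n j) (y i)
  have hf : ∀ j, HasSum (f j) ((bilateralShift p ^ n j) x -
      (s j : ℂ) • translatedBlock p 0 (y j)) := by
    intro j
    have h1 := hx.mapL (bilateralShift p ^ n j)
    simp only [map_smul, bilateralShift_pow_translatedBlock] at h1
    have h2 := h1.update j 0
    rw [sub_self, zero_sub, neg_add_eq_sub] at h2
    refine h2.congr_fun ?_
    intro i
    simp only [f, Function.update_apply]
  have hsum : HasSum (fun i => ∑ j ∈ F, c j • f j i) (∑ j ∈ F, c j • ((bilateralShift p ^ n j) x -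
      (s j : ℂ) • translatedBlock p 0 (y j))) :=
    hasSum_sum fun j _ => (hf j).const_smul (c j)
  refine le_of_tendsto hsum.norm (Filter.Eventually.of_forall fun I => ?_)
  -- The errors combine into one sum over pairs `i ≠ j`, placed at the distinct positions `n i - n
  -- j`; its coefficients `s i * c j` have a product `ℓ_p`-norm.
  have hre : ∑ i ∈ I, ∑ j ∈ F, c j • f j i =
      ∑ q ∈ (I ×ˢ F).filter (fun q => q.1 ≠ q.2),
        (s q.1 * c q.2 : ℂ) • translatedBlock p (n q.1 - n q.2) (y q.1) := by
    rw [Finset.sum_filter, Finset.sum_product]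
    refine Finset.sum_congr rfl fun i _ => Finset.sum_congr rfl fun j _ => ?_
    by_cases hij : i = j
    · simp [f, hij]
    · rw [if_pos hij, mul_comm, ← smul_smul]
      simp only [f, if_neg hij]
  rw [hre]
  refine (norm_sum_smul_translatedBlock_le p hp _ (τ := fun q : ι × ι => (n q.1 : ℤ) - n q.2) ?_ hg
    fun q m => hy q.1 m).trans ?_
  · intro q hq q' _ h
    obtain ⟨h1, h2⟩ := hsidon q.1 q.2 q'.1 q'.2 (Finset.mem_filter.1 hq).2 h
    exact Prod.ext h1 h2
  · rw [mul_assoc]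
    refine mul_le_mul_of_nonneg_left ?_ hG
    rw [← Real.mul_rpow (tsum_nonneg fun i => Real.rpow_nonneg (hs i) _) (by positivity)]
    refine Real.rpow_le_rpow (by positivity) ?_ (by positivity)
    calc _ ≤ ∑ q ∈ I ×ˢ F, ‖(s q.1 * c q.2 : ℂ)‖ ^ p.toReal :=
          Finset.sum_le_sum_of_subset_of_nonneg (Finset.filter_subset _ _)
            fun _ _ _ => by positivity
      _ = (∑ i ∈ I, s i ^ p.toReal) * ∑ j ∈ F, ‖c j‖ ^ p.toReal := by
          rw [Finset.sum_mul_sum, Finset.sum_product]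
          refine Finset.sum_congr rfl fun i _ => Finset.sum_congr rfl fun j _ => ?_
          rw [norm_mul, Complex.norm_real, Real.norm_of_nonneg (hs i),
            Real.mul_rpow (hs i) (norm_nonneg _)]
      _ ≤ _ := by
          refine mul_le_mul_of_nonneg_right ?_ (by positivity)
          exact hsp.sum_le_tsum I fun i _ => Real.rpow_nonneg (hs i) _

end Construction

/-! ### Positions, blocks and weights -/

/-- Moving terms across gives equal sums of two powers. The larger exponent `b` is determined, since
such a sum lies strictly between `3 ^ b` and `3 ^ (b + 1)`. -/
theorem three_pow_sub_injective {a b c d : ℕ} (hab : a ≠ b)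
    (h : (3 : ℤ) ^ a - 3 ^ b = 3 ^ c - 3 ^ d) : a = c ∧ b = d := by
  have key : ∀ {a b c d : ℕ}, a ≤ b → c ≤ d → 3 ^ a + 3 ^ b = 3 ^ c + 3 ^ d → a = c ∧ b = d := by
    intro a b c d hab hcd h
    have h1 : 3 ^ a ≤ 3 ^ b := Nat.pow_le_pow_right (by norm_num) hab
    have h2 : 3 ^ c ≤ 3 ^ d := Nat.pow_le_pow_right (by norm_num) hcd
    have h3 : 0 < 3 ^ a := by positivity
    have h4 : 0 < 3 ^ c := by positivity
    have hbd : b = d := by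
      have e1 : 3 ^ b < 3 ^ (d + 1) := by rw [pow_succ]; omega
      have e2 : 3 ^ d < 3 ^ (b + 1) := by rw [pow_succ]; omega
      have := (Nat.pow_lt_pow_iff_right (by norm_num)).1 e1
      have := (Nat.pow_lt_pow_iff_right (by norm_num)).1 e2
      omega
    subst hbd
    exact ⟨Nat.pow_right_injective (le_refl 2 |>.trans (Nat.le_succ 2)) (by simpa using h), rfl⟩
  have h' : 3 ^ a + 3 ^ d = 3 ^ c + 3 ^ b := by
    zify
    linarith
  rcases le_total a d with had | had <;> rcases le_total c b with hcb | hcb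
  · obtain ⟨h1, h2⟩ := key had hcb h'
    exact ⟨h1, h2.symm⟩
  · obtain ⟨h1, h2⟩ := key had hcb (h'.trans (add_comm _ _))
    exact absurd h1 hab
  · obtain ⟨h1, h2⟩ := key had hcb ((add_comm _ _).trans h')
    exact absurd h2 hab
  · obtain ⟨h1, h2⟩ := key had hcb ((add_comm _ _).trans (h'.trans (add_comm _ _)))
    exact ⟨h2, h1.symm⟩

theorem exists_finsupp_translatedBlock_dense {p : ℝ≥0∞} [Fact (1 ≤ p)] (hp : p ≠ ∞) :
    ∃ u : ℕ → ℤ →₀ ℂ, DenseRange fun k => translatedBlock p 0 (u k) := by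
  have hsub : (Submodule.span ℂ (Set.range fun m : ℤ =>
      (lp.single p m 1 : lp (fun _ : ℤ => ℂ) p)) : Set _) ⊆ Set.range (translatedBlock p 0) := by
    intro v hv
    obtain ⟨c, rfl⟩ := (Finsupp.mem_span_range_iff_exists_finsupp).1 hv
    refine ⟨c, Finset.sum_congr rfl fun m _ => ?_⟩
    simp only [zero_add]
    exact (congrArg (lp.single p m) (mul_one (c m))).symm.trans
      (lp.single_smul (E := fun _ : ℤ => ℂ) p m (c m) 1)
  have hdense : Dense (Submodule.span ℂ (Set.range fun m : ℤ =>
      (lp.single p m 1 : lp (fun _ : ℤ => ℂ) p)) : Set (lp (fun _ : ℤ => ℂ) p)) := by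
    intro v
    refine mem_closure_of_tendsto (lp.hasSum_single hp v) (Filter.Eventually.of_forall fun F => ?_)
    refine Submodule.sum_mem _ fun m _ => ?_
    have : (lp.single p m (v m) : lp (fun _ : ℤ => ℂ) p) = v m • lp.single p m 1 :=
      (congrArg (lp.single p m) (mul_one (v m))).symm.trans
        (lp.single_smul (E := fun _ : ℤ => ℂ) p m (v m) 1)
    rw [this]
    exact Submodule.smul_mem _ _ (Submodule.subset_span ⟨m, rfl⟩)
  have hsep : TopologicalSpace.SeparableSpace (lp (fun _ : ℤ => ℂ) p) := by
    rw [← TopologicalSpace.isSeparable_univ_iff, ← hdense.closure_eq]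
    exact ((Set.countable_range _).isSeparable.span (R := ℂ)).closure
  have : SecondCountableTopology (lp (fun _ : ℤ => ℂ) p) :=
    UniformSpace.secondCountable_of_separable _
  obtain ⟨t, htsub, htc, htd⟩ := (hdense.mono hsub).exists_countable_dense_subset
  obtain ⟨f, hf⟩ := htc.exists_eq_range htd.nonempty
  choose u hu using fun k => htsub (hf ▸ Set.mem_range_self k : f k ∈ t)
  refine ⟨u, ?_⟩
  simp only [hu]
  rw [DenseRange, ← hf]
  exact htd

/-- Puts all blocks under one summable majorant; a projective orbit does not see the rescaling. -/
theorem exists_pos_smul_le {g : ℤ → ℝ} (hg : ∀ m, 0 < g m) (u : ℤ →₀ ℂ) :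
    ∃ t : ℝ, 0 < t ∧ ∀ m, ‖((t : ℂ) • u) m‖ ≤ g m := by
  set A := 1 + ∑ m ∈ u.support, ‖u m‖ / g m
  have hA : 0 < A := by
    have : 0 ≤ ∑ m ∈ u.support, ‖u m‖ / g m :=
      Finset.sum_nonneg fun m _ => div_nonneg (norm_nonneg _) (hg m).le
    positivity
  refine ⟨A⁻¹, inv_pos.2 hA, fun m => ?_⟩
  rw [Finsupp.smul_apply, norm_smul, Complex.norm_real, Real.norm_of_nonneg (inv_pos.2 hA).le,
    inv_mul_le_iff₀ hA]
  by_cases hm : m ∈ u.support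
  · have h1 : ‖u m‖ / g m ≤ A :=
      (Finset.single_le_sum (f := fun m => ‖u m‖ / g m)
        (fun m _ => div_nonneg (norm_nonneg _) (hg m).le) hm).trans (by simp [A])
    exact (div_le_iff₀ (hg m)).1 h1
  · rw [Finsupp.notMem_support_iff.1 hm, norm_zero]
    exact mul_nonneg hA.le (hg m).le

/-- The exponent `1 / 2` is the borderline: `r > 2` gives convergence, while each row has a harmonic
sum of squares. The geometric factor makes the sum over rows converge. -/
theorem summable_two_pow_mul_inv_sqrt {r : ℝ} (hr : 2 < r) :
    Summable fun i : ℕ × ℕ => ((1 / 2 : ℝ) ^ i.1 * ((i.2 + 1 : ℝ) ^ (-(1 / 2) : ℝ))) ^ r := by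
  have h1 : Summable fun k : ℕ => ((1 / 2 : ℝ) ^ r) ^ k :=
    summable_geometric_of_lt_one (by positivity)
      (Real.rpow_lt_one (by norm_num) (by norm_num) (by linarith))
  have h2 : Summable fun l : ℕ => ((l + 1 : ℕ) : ℝ) ^ (-(r / 2)) :=
    (summable_nat_add_iff 1).2 (Real.summable_nat_rpow.2 (by linarith))
  refine (h1.mul_of_nonneg h2 (fun _ => by positivity) fun _ => by positivity).congr fun i => ?_
  rw [Real.mul_rpow (by positivity) (by positivity), ← Real.rpow_mul (by positivity),
    ← Real.rpow_natCast, ← Real.rpow_natCast, ← Real.rpow_mul (by norm_num),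
    ← Real.rpow_mul (by norm_num), mul_comm r]
  push_cast
  ring_nf

theorem not_summable_two_pow_mul_inv_sqrt_sq (k : ℕ) :
    ¬ Summable fun l : ℕ => ((1 / 2 : ℝ) ^ k * ((l + 1 : ℝ) ^ (-(1 / 2) : ℝ))) ^ 2 := by
  intro h
  have h1 : Summable fun l : ℕ => ((1 / 2 : ℝ) ^ k) ^ 2 * (((l + 1 : ℕ) : ℝ))⁻¹ := by
    refine h.congr fun l => ?_
    rw [mul_pow, ← Real.rpow_natCast ((l + 1 : ℝ) ^ _), ← Real.rpow_mul (by positivity)]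
    norm_num [Real.rpow_neg_one]
  rw [summable_mul_left_iff (by positivity)] at h1
  exact Real.not_summable_natCast_inv ((summable_nat_add_iff 1).1 h1)

/-! ### Weak supercyclicity for `p > 2` -/

theorem isWeaklySupercyclic_bilateralShift {p : ℝ≥0∞} [Fact (1 ≤ p)] (hp : p ≠ ∞) (h2 : 2 < p) :
    IsWeaklySupercyclic (bilateralShift p) := by
  have hr : 2 < p.toReal := by
    have := (ENNReal.toReal_lt_toReal (by norm_num) hp).2 h2
    simpa using this
  have hr0 : 0 < p.toReal := by linarith
  obtain ⟨u, hu⟩ := exists_finsupp_translatedBlock_dense (p := p) hp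
  obtain ⟨g, hg, hgs⟩ : ∃ g : ℤ → ℝ, (∀ m, 0 < g m) ∧ Summable g := by
    obtain ⟨g, hg, c, hc, -⟩ := posSumOfEncodable (zero_lt_one (α := ℝ)) ℤ
    exact ⟨g, hg, hc.summable⟩
  choose t ht hty using fun k => exists_pos_smul_le hg (u k)
  set s : ℕ × ℕ → ℝ := fun i => (1 / 2 : ℝ) ^ i.1 * ((i.2 + 1 : ℝ) ^ (-(1 / 2) : ℝ))
  have hs : ∀ i, 0 < s i := fun i => by positivity
  have hsp : Summable fun i => s i ^ p.toReal := summable_two_pow_mul_inv_sqrt hr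
  set n : ℕ × ℕ → ℕ := fun i => 3 ^ Nat.pair i.1 i.2
  have hpair : ∀ {i j : ℕ × ℕ}, Nat.pair i.1 i.2 = Nat.pair j.1 j.2 → i = j := fun {i j} h => by
    obtain ⟨h1, h2⟩ := Nat.pair_eq_pair.1 h
    exact Prod.ext h1 h2
  have hn : Function.Injective n := fun i j h =>
    hpair (Nat.pow_right_injective (by norm_num) h)
  have hsidon : ∀ i j i' j', i ≠ j → (n i : ℤ) - n j = n i' - n j' → i = i' ∧ j = j' := by
    intro i j i' j' hij h
    simp only [n] at h
    push_cast at h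
    obtain ⟨h1, h2⟩ := three_pow_sub_injective (fun e => hij (hpair e)) h
    exact ⟨hpair h1, hpair h2⟩
  set y : ℕ × ℕ → ℤ →₀ ℂ := fun i => (t i.1 : ℂ) • u i.1
  have hy : ∀ i m, ‖y i m‖ ≤ g m := fun i m => hty i.1 m
  set x := ∑' i, (s i : ℂ) • translatedBlock p (n i) (y i)
  refine ⟨x, ?_⟩
  have hmem : ∀ k, toWeakSpace ℂ _ (translatedBlock p 0 (u k)) ∈
      closure (toWeakSpace ℂ _ '' projectiveOrbit (bilateralShift p) x) := by
    intro k
    refine mem_closure_toWeakSpace_image fun W ε hε => ?_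
    set C : ℝ := (∑' m, g m) * (∑' i, s i ^ p.toReal) ^ (1 / p.toReal)
    have hC : 0 ≤ C := mul_nonneg (tsum_nonneg fun m => (hg m).le)
      (Real.rpow_nonneg (tsum_nonneg fun i => Real.rpow_nonneg (hs i).le _) _)
    set R : ℕ → lp (fun _ : ℤ => ℂ) p := fun l => (bilateralShift p ^ n (k, l)) x -
        (s (k, l) : ℂ) • translatedBlock p 0 (y (k, l))
    have hR : ∀ (F : Finset ℕ) (c : ℕ → ℂ),
        ‖∑ l ∈ F, c l • R l‖ ≤ C * (∑ l ∈ F, ‖c l‖ ^ p.toReal) ^ (1 / p.toReal) := by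
      intro F c
      have h := norm_sum_smul_shift_sub_le hr0 (fun i => (hs i).le) hsp hn hsidon hgs hy
        (F.map ⟨fun l => (k, l), Prod.mk_right_injective k⟩) (fun i => c i.2)
      simpa only [Finset.sum_map, Function.Embedding.coeFn_mk] using h
    obtain ⟨l, hl⟩ := exists_forall_norm_lt_of_upper_estimate (s := fun l => s (k, l))
      (fun l => hs _) hr0 hC hR (hsp.comp_injective (Prod.mk_right_injective k))
      (not_summable_two_pow_mul_inv_sqrt_sq k) W (mul_pos hε (ht k))
    have hts : ((t k * s (k, l) : ℝ) : ℂ) ≠ 0 :=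
      Complex.ofReal_ne_zero.2 (mul_pos (ht k) (hs _)).ne'
    -- The scalar undoes both the weight `s (k, l)` and the normalization `t k`.
    refine ⟨((t k * s (k, l) : ℝ) : ℂ)⁻¹ • (bilateralShift p ^ n (k, l)) x, ⟨_, _, rfl⟩,
      fun w hw => ?_⟩
    have hRl : ((t k * s (k, l) : ℝ) : ℂ)⁻¹ • (bilateralShift p ^ n (k, l)) x -
        translatedBlock p 0 (u k) = ((t k * s (k, l) : ℝ) : ℂ)⁻¹ • R l := by
      have : (s (k, l) : ℂ) • translatedBlock p 0 (y (k, l)) =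
          ((t k * s (k, l) : ℝ) : ℂ) • translatedBlock p 0 (u k) := by
        simp only [y, translatedBlock_smul, smul_smul]
        push_cast
        rw [mul_comm]
      simp only [R]
      rw [this, smul_sub, smul_smul, inv_mul_cancel₀ hts, one_smul]
    rw [hRl, map_smul, norm_smul, norm_inv, Complex.norm_real,
      Real.norm_of_nonneg (mul_pos (ht k) (hs _)).le, inv_mul_lt_iff₀ (mul_pos (ht k) (hs _))]
    calc _ < ε * t k * s (k, l) := hl w hw
      _ = _ := by ring
  -- A weakly closed set is norm closed, so containing the norm-dense `u k` suffices.
  have hclosed : IsClosed (toWeakSpaceCLM ℂ (lp (fun _ : ℤ => ℂ) p) ⁻¹'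
      closure (toWeakSpace ℂ _ '' projectiveOrbit (bilateralShift p) x)) :=
    isClosed_closure.preimage (toWeakSpaceCLM ℂ _).continuous
  have huniv := hu.closure_eq ▸ hclosed.closure_subset_iff.2 (Set.range_subset_iff.2 hmem)
  exact fun z => huniv (Set.mem_univ ((toWeakSpace ℂ _).symm z))

/-! ### Bang's lemma and a plank theorem -/

/-- Bang's lemma: for suitable signs the signed sum of the `v i` has a large inner product with
each of them. -/
theorem exists_signs_norm_sq_le_norm_inner {H ι : Type*} [NormedAddCommGroup H]
    [InnerProductSpace ℂ H] [Fintype ι] (v : ι → H) :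
    ∃ ε : ι → ℤˣ, ∀ i, ‖v i‖ ^ 2 ≤ ‖inner ℂ (∑ j, ((ε j : ℤ) : ℂ) • v j) (v i)‖ := by
  classical
  -- Choose signs of maximal norm: flipping the `i`-th one subtracts `w = 2 ε i v i` and cannot
  -- increase the norm, so `‖w‖ ^ 2 ≤ 2 Re ⟨u, w⟩`.
  obtain ⟨ε, hε⟩ := Finite.exists_max fun ε : ι → ℤˣ => ‖∑ j, ((ε j : ℤ) : ℂ) • v j‖
  refine ⟨ε, fun i => ?_⟩
  set u := ∑ j, ((ε j : ℤ) : ℂ) • v j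
  set w := (2 * ((ε i : ℤ) : ℂ)) • v i
  have hεi : ‖((ε i : ℤ) : ℂ)‖ = 1 := by
    rcases Int.units_eq_one_or (ε i) with h | h <;> simp [h]
  have hflip : ∑ j, ((Function.update ε i (-ε i) j : ℤ) : ℂ) • v j = u - w := by
    rw [eq_sub_iff_add_eq, ← Finset.add_sum_erase _ _ (Finset.mem_univ i), add_right_comm]
    simp only [u, ← Finset.add_sum_erase _ _ (Finset.mem_univ i)]
    congr 1
    · simp only [Function.update_self, w, ← add_smul]
      push_cast
      ring_nf
    · refine Finset.sum_congr rfl fun j hj => ?_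
      rw [Function.update_of_ne (Finset.ne_of_mem_erase hj)]
  have hle : ‖u - w‖ ≤ ‖u‖ := hflip ▸ hε (Function.update ε i (-ε i))
  have hsq : ‖u - w‖ ^ 2 ≤ ‖u‖ ^ 2 := by gcongr
  rw [norm_sub_sq (𝕜 := ℂ)] at hsq
  have hw : ‖w‖ ^ 2 = 4 * ‖v i‖ ^ 2 := by
    rw [norm_smul, norm_mul, hεi, Complex.norm_ofNat]
    ring
  have hin : RCLike.re (inner ℂ u w) ≤ 2 * ‖inner ℂ u (v i)‖ := by
    refine (RCLike.re_le_norm _).trans ?_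
    rw [inner_smul_right, norm_mul, norm_mul, hεi, Complex.norm_ofNat, mul_one]
  linarith

/-- A plank theorem for Bessel sequences: if `∑ a i ^ 2 < ∞`, then some functional has modulus
at least `a i * ‖v i‖ ^ 2` at every `v i`. -/
theorem exists_dual_forall_le_of_bessel {H ι : Type*} [NormedAddCommGroup H]
    [InnerProductSpace ℂ H] {v : ι → H} {C : ℝ} (hC : 0 ≤ C)
    (hv : ∀ (F : Finset ι) (c : ι → ℂ), ‖∑ i ∈ F, c i • v i‖ ^ 2 ≤ C * ∑ i ∈ F, ‖c i‖ ^ 2)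
    {a : ι → ℝ} (ha : ∀ i, 0 ≤ a i) (ha2 : Summable fun i => a i ^ 2) :
    ∃ φ : H →L[ℂ] ℂ, ∀ i, a i * ‖v i‖ ^ 2 ≤ ‖φ (v i)‖ := by
  classical
  -- The Bessel bound for every signed finite sum of the `a i • v i`; being independent of the
  -- finite set, it permits weak-* compactness.
  set K := √(C * ∑' i, a i ^ 2)
  have hcomp := WeakDual.isCompact_closedBall (𝕜 := ℂ) (E := H) 0 K
  obtain ⟨φ, -, hφ⟩ := hcomp.inter_iInter_nonempty
    (fun i => {φ : WeakDual ℂ H | a i * ‖v i‖ ^ 2 ≤ ‖φ (v i)‖})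
    (fun i => isClosed_le continuous_const (WeakDual.eval_continuous (v i)).norm) (by
      intro F
      obtain ⟨ε, hε⟩ := exists_signs_norm_sq_le_norm_inner fun i : F => (a i : ℂ) • v i
      set e : ι → ℂ := fun i => if h : i ∈ F then ((ε ⟨i, h⟩ : ℤ) : ℂ) * a i else 0
      set u := ∑ i : F, ((ε i : ℤ) : ℂ) • (a i : ℂ) • v i
      have hu : u = ∑ i ∈ F, e i • v i := by
        rw [← Finset.sum_coe_sort F]
        refine Finset.sum_congr rfl fun i _ => ?_
        simp only [e, i.2, dif_pos, Subtype.coe_eta, smul_smul]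
      have he : ∀ i ∈ F, ‖e i‖ ^ 2 = a i ^ 2 := by
        intro i hi
        simp only [e, dif_pos hi]
        rcases Int.units_eq_one_or (ε ⟨i, hi⟩) with h | h <;> simp [h]
      have huK : ‖u‖ ≤ K := by
        refine Real.le_sqrt_of_sq_le ?_
        calc ‖u‖ ^ 2 ≤ C * ∑ i ∈ F, ‖e i‖ ^ 2 := hu ▸ hv F e
          _ = C * ∑ i ∈ F, a i ^ 2 := by rw [Finset.sum_congr rfl he]
          _ ≤ _ := by
            gcongr
            exact ha2.sum_le_tsum F fun i _ => sq_nonneg _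
      refine ⟨StrongDual.toWeakDual (innerSL ℂ u), ?_, ?_⟩
      · rw [Set.mem_preimage, mem_closedBall_zero_iff]
        exact (innerSL_apply_norm ℂ u).trans_le huK
      · rw [Set.mem_iInter₂]
        intro i hi
        rcases (ha i).eq_or_lt with h0 | h0
        · simp [← h0]
        · have h := hε ⟨i, hi⟩
          simp only [norm_smul, inner_smul_right, norm_mul, Complex.norm_real,
            Real.norm_of_nonneg (ha i)] at h
          have h' : a i * (a i * ‖v i‖ ^ 2) ≤ a i * ‖inner ℂ u (v i)‖ := by
            calc _ = (a i * ‖v i‖) ^ 2 := by ring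
              _ ≤ _ := h
          exact le_of_mul_le_mul_left h' h0)
  exact ⟨WeakDual.toStrongDual φ, fun i => Set.mem_iInter.1 hφ i⟩

/-! ### Fourier side of the shift on `ℓ_2(ℤ)` -/

open MeasureTheory AddCircle

theorem exists_inclusion_lp_two {p : ℝ≥0∞} [Fact (1 ≤ p)] (h : p ≤ 2) :
    ∃ J : lp (fun _ : ℤ => ℂ) p →L[ℂ] lp (fun _ : ℤ => ℂ) 2, ∀ x n, J x n = x n := by
  let J : lp (fun _ : ℤ => ℂ) p →ₗ[ℂ] lp (fun _ : ℤ => ℂ) 2 :=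
    { toFun := fun x => ⟨x, (lp.memℓp x).of_exponent_ge h⟩
      map_add' := fun _ _ => rfl
      map_smul' := fun _ _ => rfl }
  have hJ : Continuous J := by
    -- Closed graph theorem: both limits are determined by their coordinates.
    refine J.continuous_of_seq_closed_graph fun u x y hu hy => ?_
    have h1 := (lp.uniformContinuous_coe (E := fun _ : ℤ => ℂ) (p := p)).continuous.tendsto x
      |>.comp hu
    have h2 := (lp.uniformContinuous_coe (E := fun _ : ℤ => ℂ) (p := 2)).continuous.tendsto y
      |>.comp hy
    exact lp.ext (tendsto_nhds_unique h2 h1)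
  exact ⟨⟨J, hJ⟩, fun _ _ => rfl⟩

theorem ae_eq_repr_symm_bilateralShift_pow (x : lp (fun _ : ℤ => ℂ) 2) (n : ℕ) :
    (fourierBasis (T := 1)).repr.symm ((bilateralShift 2 ^ n) x) =ᵐ[haarAddCircle]
      fun z => fourier (-n : ℤ) z * (fourierBasis (T := 1)).repr.symm x z := by
  set f := (fourierBasis (T := 1)).repr.symm x
  set G : Lp ℂ 2 (haarAddCircle (T := 1)) :=
    (ContinuousLinearMap.mul ℂ ℂ).holderL haarAddCircle ∞ 2 2 (fourierLp ∞ (-n : ℤ)) f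
  have hG : G =ᵐ[haarAddCircle] fun z => fourier (-n : ℤ) z * f z := by
    filter_upwards [(ContinuousLinearMap.mul ℂ ℂ).coeFn_holder (r := 2) (fourierLp ∞ (-n : ℤ)) f,
      coeFn_fourierLp ∞ (-n : ℤ)] with z h1 h2
    rw [← h2]
    exact h1
  have hrepr : (bilateralShift 2 ^ n) x = (fourierBasis (T := 1)).repr G := by
    ext m
    have hx : x (m + n) = fourierCoeff f (m + n) := by
      rw [← fourierBasis_repr, LinearIsometryEquiv.apply_symm_apply]
    rw [bilateralShift_pow_apply, fourierBasis_repr, hx, fourierCoeff, fourierCoeff]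
    refine integral_congr_ae ?_
    filter_upwards [hG] with z hz
    rw [hz, neg_add, fourier_add, smul_eq_mul, smul_eq_mul, mul_assoc]
  rw [hrepr, LinearIsometryEquiv.symm_apply_apply]
  exact hG

/-- Some bounded multiplier with nonvanishing symbol maps `f` to a bounded function. -/
theorem exists_multiplier_mul_bounded {α : Type*} [MeasurableSpace α] {μ : Measure α}
    (f : Lp ℂ 2 μ) : ∃ h k : Lp ℂ ∞ μ, (∀ᵐ z ∂μ, h z ≠ 0) ∧ ∀ᵐ z ∂μ, k z = h z * f z := by
  -- The multiplier is `1 / (1 + |f| ^ 2)`; its product with `f` is bounded by `1` because `t ≤ 1 +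
  -- t ^ 2`.
  have hpos : ∀ z, 0 < 1 + ‖f z‖ ^ 2 := fun z => by positivity
  have hm : AEStronglyMeasurable (fun z => (((1 + ‖f z‖ ^ 2)⁻¹ : ℝ) : ℂ)) μ := by
    have := (Lp.aestronglyMeasurable f).aemeasurable
    exact (Complex.measurable_ofReal.comp_aemeasurable
      ((this.norm.pow_const 2).const_add 1).inv).aestronglyMeasurable
  have hle : ∀ z, (1 + ‖f z‖ ^ 2)⁻¹ ≤ 1 := fun z => inv_le_one_of_one_le₀ (by nlinarith)
  have hh : MemLp (fun z => (((1 + ‖f z‖ ^ 2)⁻¹ : ℝ) : ℂ)) ∞ μ := by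
    refine memLp_top_of_bound hm 1 (Filter.Eventually.of_forall fun z => ?_)
    rw [Complex.norm_real, Real.norm_of_nonneg (inv_pos.2 (hpos z)).le]
    exact hle z
  have hk : MemLp (fun z => (((1 + ‖f z‖ ^ 2)⁻¹ : ℝ) : ℂ) * f z) ∞ μ := by
    refine memLp_top_of_bound (hm.mul (Lp.aestronglyMeasurable f)) 1
      (Filter.Eventually.of_forall fun z => ?_)
    rw [norm_mul, Complex.norm_real, Real.norm_of_nonneg (inv_pos.2 (hpos z)).le,
      inv_mul_le_iff₀ (hpos z)]
    nlinarith [sq_nonneg (‖f z‖ - 1)]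
  refine ⟨hh.toLp, hk.toLp, ?_, ?_⟩
  · filter_upwards [hh.coeFn_toLp] with z hz
    rw [hz]
    exact Complex.ofReal_ne_zero.2 (inv_pos.2 (hpos z)).ne'
  · filter_upwards [hh.coeFn_toLp, hk.coeFn_toLp] with z hz1 hz2
    rw [hz1, hz2]

/-- For every nonzero `x ∈ ℓ_2(ℤ)` some functional is bounded below along the orbit of `x` under the
bilateral shift by a given square-summable sequence, up to a positive factor. -/
theorem exists_functional_lower_bound {x : lp (fun _ : ℤ => ℂ) 2} (hx : x ≠ 0) {a : ℕ → ℝ}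
    (ha : ∀ n, 0 ≤ a n) (ha2 : Summable fun n => a n ^ 2) :
    ∃ (ψ : lp (fun _ : ℤ => ℂ) 2 →L[ℂ] ℂ) (δ : ℝ), 0 < δ ∧
      ∀ n : ℕ, δ * a n ≤ ‖ψ ((bilateralShift 2 ^ n) x)‖ := by
  set Φ := (fourierBasis (T := 1)).repr.symm
  obtain ⟨h, k, hne, hk⟩ := exists_multiplier_mul_bounded (Φ x)
  set Mh := (ContinuousLinearMap.mul ℂ ℂ).holderL (haarAddCircle (T := 1)) ∞ 2 2 h
  set Mk := (ContinuousLinearMap.mul ℂ ℂ).holderL (haarAddCircle (T := 1)) ∞ 2 2 k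
  have hMh : ∀ f, Mh f =ᵐ[haarAddCircle] fun z => h z * f z :=
    fun f => (ContinuousLinearMap.mul ℂ ℂ).coeFn_holder (r := 2) h f
  have hMk : ∀ f, Mk f =ᵐ[haarAddCircle] fun z => k z * f z :=
    fun f => (ContinuousLinearMap.mul ℂ ℂ).coeFn_holder (r := 2) k f
  set v : ℕ → Lp ℂ 2 (haarAddCircle (T := 1)) := fun n => Mh (Φ ((bilateralShift 2 ^ n) x))
  have hv : ∀ n, v n =ᵐ[haarAddCircle] fun z => h z * (fourier (-n : ℤ) z * Φ x z) := by
    intro n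
    filter_upwards [hMh (Φ ((bilateralShift 2 ^ n) x)), ae_eq_repr_symm_bilateralShift_pow x n]
      with z h1 h2
    rw [h1, h2]
  -- As `k = h * Φ x` is bounded, the `v n` are images of orthonormal characters under a bounded
  -- operator; this is the source of the Bessel estimate.
  have hvk : ∀ n : ℕ, v n = Mk (fourierLp 2 (-n : ℤ)) := by
    intro n
    refine Lp.ext ?_
    filter_upwards [hv n, hMk (fourierLp 2 (-n : ℤ)), hk, coeFn_fourierLp 2 (-n : ℤ)]
      with z h1 h2 h3 h4
    rw [h1, h2, h3, h4]
    ring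
  have hnorm : ∀ n, ‖v n‖ = ‖v 0‖ := by
    intro n
    rw [Lp.norm_def, Lp.norm_def]
    congr 1
    refine eLpNorm_congr_norm_ae ?_
    filter_upwards [hv n, hv 0] with z h1 h2
    simp only [h1, h2, norm_mul, fourier_apply, Circle.norm_coe]
  have hv0 : v 0 ≠ 0 := by
    intro h0
    refine hx ((LinearIsometryEquiv.map_eq_zero_iff Φ).1 (Lp.ext ?_))
    have h1 := hv 0
    rw [h0] at h1
    filter_upwards [h1, Lp.coeFn_zero ℂ 2 (haarAddCircle (T := 1)), hne] with z h1 h2 h3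
    rw [h2] at h1 ⊢
    have : h z * Φ x z = 0 := by simpa using h1.symm
    exact (mul_eq_zero.1 this).resolve_left h3
  have hortho : Orthonormal ℂ fun n : ℕ => fourierLp (T := 1) 2 (-n : ℤ) :=
    orthonormal_fourier.comp _ fun m n h => by simpa using h
  have hbessel : ∀ (F : Finset ℕ) (c : ℕ → ℂ),
      ‖∑ n ∈ F, c n • v n‖ ^ 2 ≤ ‖Mk‖ ^ 2 * ∑ n ∈ F, ‖c n‖ ^ 2 := by
    intro F c
    have h1 : ∑ n ∈ F, c n • v n = Mk (∑ n ∈ F, c n • fourierLp 2 (-n : ℤ)) := by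
      simp only [map_sum, map_smul, hvk]
    have h2 : ‖∑ n ∈ F, c n • fourierLp (T := 1) 2 (-n : ℤ)‖ ^ 2 = ∑ n ∈ F, ‖c n‖ ^ 2 := by
      have h3 := hortho.inner_sum c c F
      rw [inner_self_eq_norm_sq_to_K] at h3
      simp only [RCLike.conj_mul] at h3
      exact_mod_cast h3
    rw [h1, ← h2, ← mul_pow]
    gcongr
    exact Mk.le_opNorm _
  obtain ⟨φ, hφ⟩ := exists_dual_forall_le_of_bessel (sq_nonneg ‖Mk‖) hbessel ha ha2
  refine ⟨φ ∘L Mh ∘L (Φ.toContinuousLinearEquiv : _ →L[ℂ] _), ‖v 0‖ ^ 2, by positivity,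
    fun n => ?_⟩
  rw [mul_comm, ← hnorm n]
  exact hφ n

/-! ### Failure of weak supercyclicity for `p ≤ 2` -/

theorem not_isWeaklySupercyclic_bilateralShift {p : ℝ≥0∞} [Fact (1 ≤ p)] (h2 : p ≤ 2) :
    ¬ IsWeaklySupercyclic (bilateralShift p) := by
  rintro ⟨x, hx⟩
  obtain ⟨J, hJ⟩ := exists_inclusion_lp_two h2
  have hshift : ∀ n : ℕ, J ((bilateralShift p ^ n) x) = (bilateralShift 2 ^ n) (J x) := by
    intro n
    ext m
    rw [hJ, bilateralShift_pow_apply, bilateralShift_pow_apply, hJ]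
  have hsq : Summable fun m : ℤ => ‖J x m‖ ^ 2 := by
    have := (lp.memℓp (J x)).summable (by norm_num)
    simpa using this
  -- The lower bound is the sum of the moduli of coordinates `0` and `1` of `B ^ n x`,
  -- square-summable in `n`. Two coordinates are needed to contradict the codimension of `ker ψ`.
  obtain ⟨ψ, δ, hδ, hψ⟩ : ∃ (ψ : lp (fun _ : ℤ => ℂ) p →L[ℂ] ℂ) (δ : ℝ), 0 < δ ∧
      ∀ n : ℕ, δ * (‖x n‖ + ‖x (n + 1)‖) ≤ ‖ψ ((bilateralShift p ^ n) x)‖ := by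
    rcases eq_or_ne x 0 with rfl | h0
    · exact ⟨0, 1, one_pos, fun n => by simp⟩
    · have hJ0 : J x ≠ 0 := by
        intro h
        refine h0 (lp.ext (funext fun m => ?_))
        rw [← hJ, h]
        rfl
      have hs1 : Summable fun n : ℕ => ‖J x n‖ ^ 2 := hsq.comp_injective Nat.cast_injective
      have hs2 : Summable fun n : ℕ => ‖J x (n + 1)‖ ^ 2 :=
        hsq.comp_injective ((add_left_injective (1 : ℤ)).comp Nat.cast_injective)
      obtain ⟨ψ, δ, hδ, hψ⟩ := exists_functional_lower_bound hJ0
        (a := fun n => ‖J x n‖ + ‖J x (n + 1)‖) (fun n => by positivity)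
        (((hs1.add hs2).mul_left 2).of_nonneg_of_le (fun n => by positivity) fun n =>
          add_sq_le)
      refine ⟨ψ ∘L J, δ, hδ, fun n => ?_⟩
      have h := hψ n
      rw [hJ, hJ] at h
      rwa [ContinuousLinearMap.comp_apply, hshift]
  let coord : ℤ → lp (fun _ : ℤ => ℂ) p →L[ℂ] ℂ := fun m => lp.evalCLM ℂ (fun _ : ℤ => ℂ) p m
  have hev : ∀ w : lp (fun _ : ℤ => ℂ) p →L[ℂ] ℂ,
      Continuous fun y : WeakSpace ℂ (lp (fun _ : ℤ => ℂ) p) => w ((toWeakSpace ℂ _).symm y) :=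
    fun w => WeakBilin.eval_continuous (topDualPairing ℂ _).flip w
  have hclosed : IsClosed {y : WeakSpace ℂ (lp (fun _ : ℤ => ℂ) p) |
      δ * (‖coord 0 ((toWeakSpace ℂ _).symm y)‖ + ‖coord 1 ((toWeakSpace ℂ _).symm y)‖) ≤
        ‖ψ ((toWeakSpace ℂ _).symm y)‖} :=
    isClosed_le (continuous_const.mul ((hev _).norm.add (hev _).norm)) (hev _).norm
  have hall : ∀ y : lp (fun _ : ℤ => ℂ) p, δ * (‖y 0‖ + ‖y 1‖) ≤ ‖ψ y‖ := by
    intro y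
    have hsub := closure_minimal (s := toWeakSpace ℂ _ ''
      projectiveOrbit (bilateralShift p) x) (by
        rintro _ ⟨_, ⟨c, n, rfl⟩, rfl⟩
        have h0 : (bilateralShift p ^ n) x 0 = x n := by
          rw [bilateralShift_pow_apply, zero_add]
        have h1 : (bilateralShift p ^ n) x 1 = x (n + 1) := by
          rw [bilateralShift_pow_apply, add_comm]
        change δ * (‖c * (bilateralShift p ^ n) x 0‖ + ‖c * (bilateralShift p ^ n) x 1‖) ≤
          ‖ψ (c • (bilateralShift p ^ n) x)‖
        rw [h0, h1, map_smul, norm_smul, norm_mul, norm_mul]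
        calc _ = ‖c‖ * (δ * (‖x n‖ + ‖x (n + 1)‖)) := by ring
          _ ≤ _ := mul_le_mul_of_nonneg_left (hψ n) (norm_nonneg c)) hclosed
    exact hsub (hx (toWeakSpace ℂ _ y))
  set e₀ : lp (fun _ : ℤ => ℂ) p := lp.single p 0 1
  set e₁ : lp (fun _ : ℤ => ℂ) p := lp.single p 1 1
  have he₀ : 0 < ‖ψ e₀‖ := by
    refine lt_of_lt_of_le ?_ (hall e₀)
    have : e₀ 0 = 1 := lp.single_apply_self _ _ _
    rw [this, norm_one]
    positivity
  -- This combination lies in `ker ψ`, yet its coordinate at `1` is `-ψ e₀ ≠ 0`.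
  have hcomb := hall (ψ e₁ • e₀ - ψ e₀ • e₁)
  have hz : ψ (ψ e₁ • e₀ - ψ e₀ • e₁) = 0 := by
    simp [mul_comm]
  have h1 : (ψ e₁ • e₀ - ψ e₀ • e₁) 1 = -ψ e₀ := by
    change ψ e₁ * e₀ 1 - ψ e₀ * e₁ 1 = -ψ e₀
    have ha : e₀ 1 = 0 := lp.single_apply_ne _ _ _ one_ne_zero
    have hb : e₁ 1 = 1 := lp.single_apply_self _ _ _
    rw [ha, hb]
    ring
  rw [hz, h1, norm_zero, norm_neg] at hcomb
  have : 0 < δ * (‖(ψ e₁ • e₀ - ψ e₀ • e₁ : lp (fun _ : ℤ => ℂ) p) 0‖ + ‖ψ e₀‖) := by positivity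
  linarith

theorem theorem1p5 (p : ℝ≥0∞) [Fact (1 ≤ p)] (hp : p ≠ ∞) :
    IsWeaklySupercyclic (bilateralShift p) ↔ 2 < p := by
  refine ⟨fun h => ?_, isWeaklySupercyclic_bilateralShift hp⟩
  by_contra h2
  exact not_isWeaklySupercyclic_bilateralShift (not_lt.1 h2) h
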